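/- Let $p$ be a prime, $k$ a perfect field of characteristic $p$, $V=W(k)$, and $A=W(k)[[x_2,\dots,x_d]]$ with $d\ge 1$; put $x_1:=p$. Let $\phi:A\to A$ be the Frobenius lift attached to the $p$-derivation $\delta$ with $\delta(x_j)=0$ for $2\le j\le d$, i.e. $\phi$ is the Witt vector Frobenius on $W(k)$ and $\phi(x_j)=x_j^p$ for $2\le j\le d$. Let $I\subseteq A$ be an ideal generated by squarefree monomials $x_1^{\epsilon_1}x_2^{\epsilon_2}\cdots x_d^{\epsilon_d}$, $\epsilon_j\in\{0,1\}$. Then $\phi(I)\subseteq I$; let $R=A/I$ and let $\phi_R:R\to R$ be the induced map. For $i\ge 0$ let $R_i=\operatorname{colim}(R\xrightarrow{\phi_R}\cdots\xrightarrow{\phi_R}R)$ ($i$ arrows), regarded as a $V$-algebra through $V\to R=R_0\to R_i$, with the canonical maps $R_i\to R_{i+1}$; let $V_i=V[p^{1/p^i}]=V[X]/(X^{p^i}-p)$, with $V_i\to V_{i+1}$, $p^{1/p^i}\mapsto (p^{1/p^{i+1}})^p$. Put $S_i=(R_i\otimes_V V_i)_{\mathrm{red}}$, with the induced maps $t_i:S_i\to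 S_{i+1}$. Then $S_0\to S_1\to S_2\to\cdots$ is a perfectoid tower arising from $(R,(p))$. That is, with $I_0=(p)$: (a) the canonical map $R\to S_0$ is an isomorphism, and $p\in I_0$; (b) the induced maps $\overline{t_i}:S_i/I_0S_i\to S_{i+1}/I_0S_{i+1}$ are injective; (c) the image of the Frobenius of $S_{i+1}/I_0S_{i+1}$ lies in the image of $\overline{t_i}$, so that there is a unique ring map $F_i:S_{i+1}/I_0S_{i+1}\to S_i/I_0S_i$ with $\overline{t_i}(F_i(x))=x^p$; (d) every $F_i$ is surjective; (e) $I_0S_i$ is contained in the Jacobson radical of $S_i$ for every $i$; (f) $I_0$ is principal, and there is a principal ideal $I_1\subseteq S_1$ such that $I_1^p=I_0S_1$ and $\ker F_i=I_1(S_{i+1}/I_0S_{i+1})$ for every $i\ge 0$; (g) for every $i$, $I_0$ annihilates $(S_i)_{\mathrm{tor}}=\{s\in S_i : I_0^n s=0 \text{ for some } n\}$, and there is a bijection $(S_{i+1})_{\mathrm{tor}}\to (S_i)_{\mathrm{tor}}$ compatible with $F_i$ under the maps $(S_j)_{\mathrm{tor}}\to S_j/I_0S_j$ for $j=i,i+1$.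 Moreover, for every $i\ge 0$, the ring $S_i$ contains a nonzero element killed by $p$ if and only if $R=A/I$ does, i.e. if and only if there is $a\in A\setminus I$ with $pa\in I$ (for example, this holds for $I=(px_2,px_3)$). -/

import Mathlib

universe u

open scoped TensorProduct

/-! ## Towers of rings and perfectoid towers -/

/-- A tower of rings `R₀ → R₁ → R₂ → ⋯`. -/
structure RingTower where
  ring : ℕ → Type u
  [commRing : ∀ i, CommRing (ring i)]
  map : ∀ i, ring i →+* ring (i + 1)

namespace RingTower

attribute [instance] RingTower.commRing

variable (T : RingTower.{u})

/-- The composite `R₀ → R₁ → ⋯ → Rᵢ`. -/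
def fromBase : ∀ i, T.ring 0 →+* T.ring i
  | 0 => RingHom.id _
  | i + 1 => (T.map i).comp (fromBase i)

/-- The composite `R₁ → R₂ → ⋯ → Rᵢ₊₁`. -/
def fromFirst : ∀ i, T.ring 1 →+* T.ring (i + 1)
  | 0 => RingHom.id _
  | i + 1 => (T.map (i + 1)).comp (fromFirst i)

/-- The reduced tower `(R₀)_red → (R₁)_red → ⋯` of a tower. -/
noncomputable def reduced : RingTower.{u} where
  ring i := T.ring i ⧸ nilradical (T.ring i)
  map i := Ideal.quotientMap _ (T.map i) fun _ hx =>
    mem_nilradical.mpr ((mem_nilradical.mp hx).map (T.map i))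

/-- The ring `R` is mapped to the bottom of the tower by `e` (an isomorphism in all uses below).
For an ideal `I` of `R` this is the extended ideal `I Rᵢ`. -/
def extIdeal {R : Type u} [CommRing R] (e : R →+* T.ring 0) (I : Ideal R) (i : ℕ) :
    Ideal (T.ring i) :=
  I.map ((T.fromBase i).comp e)

theorem extIdeal_le_comap {R : Type u} [CommRing R] (e : R →+* T.ring 0) (I : Ideal R) (i : ℕ) :
    T.extIdeal e I i ≤ (T.extIdeal e I (i + 1)).comap (T.map i) :=
  Ideal.map_le_iff_le_comap.mpr fun _ hx => Ideal.mem_map_of_mem _ hx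

/-- The map `Rᵢ / I Rᵢ → Rᵢ₊₁ / I Rᵢ₊₁` induced by the transition map. -/
def quotMap {R : Type u} [CommRing R] (e : R →+* T.ring 0) (I : Ideal R) (i : ℕ) :
    T.ring i ⧸ T.extIdeal e I i →+* T.ring (i + 1) ⧸ T.extIdeal e I (i + 1) :=
  Ideal.quotientMap _ (T.map i) (T.extIdeal_le_comap e I i)

/-- `T` is a `p`-purely inseparable tower arising from `(R, I)`, where the identification of `R`
with the bottom ring of the tower is the map `e`. -/
structure IsPurelyInseparable (p : ℕ) {R : Type u} [CommRing R] (e : R →+* T.ring 0)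
    (I : Ideal R) : Prop where
  /-- axiom (a), first half -/
  base_bijective : Function.Bijective e
  /-- axiom (a), second half -/
  p_mem : (p : R) ∈ I
  /-- axiom (b) -/
  quotMap_injective : ∀ i, Function.Injective (T.quotMap e I i)
  /-- axiom (c): the image of the Frobenius of `Rᵢ₊₁ / I Rᵢ₊₁` is contained in the image of
  `Rᵢ / I Rᵢ` -/
  pow_mem_range : ∀ (i : ℕ) (x : T.ring (i + 1) ⧸ T.extIdeal e I (i + 1)),
    x ^ p ∈ Set.range (T.quotMap e I i)

namespace IsPurelyInseparable

variable {T} {p : ℕ} {R : Type u} [CommRing R] {e : R →+* T.ring 0} {I : Ideal R}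

theorem natCast_eq_zero (h : T.IsPurelyInseparable p e I) (i : ℕ) :
    (p : T.ring i ⧸ T.extIdeal e I i) = 0 := by
  have h1 : (p : T.ring i) ∈ T.extIdeal e I i := by
    have := Ideal.mem_map_of_mem ((T.fromBase i).comp e) h.p_mem
    rwa [map_natCast] at this
  have h2 := Ideal.Quotient.eq_zero_iff_mem.mpr h1
  rwa [map_natCast] at h2

variable [hp : Fact p.Prime]

/-- The `i`-th Frobenius projection `Fᵢ : Rᵢ₊₁ / I Rᵢ₊₁ → Rᵢ / I Rᵢ`: the unique map whose
composite with `Rᵢ / I Rᵢ → Rᵢ₊₁ / I Rᵢ₊₁` is the Frobenius `x ↦ x ^ p`. -/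
noncomputable def frobProj (h : T.IsPurelyInseparable p e I) (i : ℕ) :
    T.ring (i + 1) ⧸ T.extIdeal e I (i + 1) →+* T.ring i ⧸ T.extIdeal e I i where
  toFun x := (h.pow_mem_range i x).choose
  map_one' := h.quotMap_injective i <| by
    rw [(h.pow_mem_range i 1).choose_spec, one_pow, map_one]
  map_zero' := h.quotMap_injective i <| by
    rw [(h.pow_mem_range i 0).choose_spec, zero_pow hp.out.ne_zero, map_zero]
  map_mul' x y := h.quotMap_injective i <| by
    rw [map_mul, (h.pow_mem_range i (x * y)).choose_spec, (h.pow_mem_range i x).choose_spec,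
      (h.pow_mem_range i y).choose_spec, mul_pow]
  map_add' x y := h.quotMap_injective i <| by
    rw [map_add, (h.pow_mem_range i (x + y)).choose_spec, (h.pow_mem_range i x).choose_spec,
      (h.pow_mem_range i y).choose_spec, add_pow_prime_eq' hp.out, h.natCast_eq_zero (i + 1),
      zero_mul, add_zero]

theorem quotMap_frobProj (h : T.IsPurelyInseparable p e I) (i : ℕ)
    (x : T.ring (i + 1) ⧸ T.extIdeal e I (i + 1)) :
    T.quotMap e I i (h.frobProj i x) = x ^ p :=
  (h.pow_mem_range i x).choose_spec

end IsPurelyInseparable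

end RingTower

/-- The `J`-torsion of a ring: the elements killed by some power of the ideal `J`. -/
def idealTorsion {R : Type u} [CommRing R] (J : Ideal R) : Set R :=
  {x | ∃ n : ℕ, ∀ a ∈ J ^ n, a * x = 0}

/-- `T` is a `p`-perfectoid tower arising from `(R, I)`, where the identification of `R` with
the bottom ring of the tower is the map `e`. -/
structure RingTower.IsPerfectoid (T : RingTower.{u}) (p : ℕ) [Fact p.Prime] {R : Type u}
    [CommRing R] (e : R →+* T.ring 0) (I : Ideal R) : Prop
    extends T.IsPurelyInseparable p e I where
  /-- axiom (d) -/
  frobProj_surjective : ∀ i, Function.Surjective (toIsPurelyInseparable.frobProj i)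
  /-- axiom (e) -/
  zariskian : ∀ i, T.extIdeal e I i ≤ Ideal.jacobson ⊥
  /-- axiom (f), first part -/
  isPrincipal : I.IsPrincipal
  /-- axiom (f), the existence of the first perfectoid pillar -/
  exists_pillar : ∃ I₁ : Ideal (T.ring 1), I₁.IsPrincipal ∧ I₁ ^ p = T.extIdeal e I 1 ∧
    ∀ i, RingHom.ker (toIsPurelyInseparable.frobProj i) =
      (I₁.map (T.fromFirst i)).map (Ideal.Quotient.mk (T.extIdeal e I (i + 1)))
  /-- axiom (g), first part -/
  mul_torsion : ∀ i, ∀ a ∈ T.extIdeal e I i, ∀ x ∈ idealTorsion (T.extIdeal e I i), a * x = 0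
  /-- axiom (g), second part -/
  exists_torsion_bijection : ∀ i,
    ∃ G : idealTorsion (T.extIdeal e I (i + 1)) → idealTorsion (T.extIdeal e I i),
      Function.Bijective G ∧ ∀ x : idealTorsion (T.extIdeal e I (i + 1)),
        toIsPurelyInseparable.frobProj i (Ideal.Quotient.mk _ (x : T.ring (i + 1))) =
          Ideal.Quotient.mk _ (G x : T.ring i)

/-! ## The tower `Rᵢ ⊗_V Vᵢ` -/

/-- The colimit of `R → R → ⋯ → R` (`i` arrows, all equal to `φ`). The last object of the diagram
is terminal in its shape, so the colimit is that last copy of `R`; see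
`FrobLayer.existsUnique_desc` for the universal property. -/
@[nolint unusedArguments]
def FrobLayer {R : Type u} [CommRing R] (_φ : R →+* R) (_i : ℕ) : Type u := R

namespace FrobLayer

variable {R : Type u} [CommRing R] (φ : R →+* R)

instance (i : ℕ) : CommRing (FrobLayer φ i) := inferInstanceAs (CommRing R)

/-- The identification of the last copy of `R` with the colimit. -/
def last (i : ℕ) : R ≃+* FrobLayer φ i := RingEquiv.refl R

/-- The map into the colimit from the `j`-th copy of `R`, for `j ≤ i`. -/
def incl (i j : ℕ) : R →+* FrobLayer φ i := (last φ i : R →+* FrobLayer φ i).comp (φ ^ (i - j))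

/-- The transition map of colimits, given by the identity on the copies `0, …, i` of `R`
(see `trans_comp_incl`). -/
def trans (i : ℕ) : FrobLayer φ i →+* FrobLayer φ (i + 1) :=
  ((last φ (i + 1) : R →+* FrobLayer φ (i + 1)).comp φ).comp
    ((last φ i).symm : FrobLayer φ i →+* R)

theorem incl_comp (i j : ℕ) (h : j < i) : (incl φ i (j + 1)).comp φ = incl φ i j := by
  have h1 : i - j = (i - (j + 1)) + 1 := by omega
  unfold incl
  rw [h1, pow_succ]
  rfl

theorem existsUnique_desc {S : Type*} [CommRing S] (i : ℕ) (f : ℕ → R →+* S)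
    (hf : ∀ j < i, (f (j + 1)).comp φ = f j) :
    ∃! g : FrobLayer φ i →+* S, ∀ j ≤ i, g.comp (incl φ i j) = f j := by
  have h0 : ∀ x, incl φ i i x = last φ i x := by
    intro x
    unfold incl
    rw [Nat.sub_self, pow_zero]
    rfl
  refine ⟨(f i).comp ((last φ i).symm : FrobLayer φ i →+* R), ?_, ?_⟩
  · intro j hj
    induction hk : i - j generalizing j with
    | zero =>
      obtain rfl : j = i := by omega
      ext x
      simp [h0]
    | succ m ih =>
      have h1 := ih (j + 1) (by omega) (by omega)
      rw [← incl_comp φ i j (by omega), ← RingHom.comp_assoc, h1, hf j (by omega)]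
  · intro g hg
    ext x
    have h2 := RingHom.congr_fun (hg i le_rfl) ((last φ i).symm x)
    rw [RingHom.comp_apply, h0, RingEquiv.apply_symm_apply] at h2
    exact h2

theorem trans_comp_incl (i j : ℕ) (h : j ≤ i) :
    (trans φ i).comp (incl φ i j) = incl φ (i + 1) j := by
  have h1 : i + 1 - j = (i - j) + 1 := by omega
  unfold incl
  rw [h1, pow_succ']
  rfl

variable {V : Type u} [CommRing V] [Algebra V R]

/-- The `V`-algebra structure `V → R = R₀ → Rᵢ`. -/
instance (i : ℕ) : Algebra V (FrobLayer φ i) :=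
  ((incl φ i 0).comp (algebraMap V R)).toAlgebra

theorem algebraMap_eq (i : ℕ) :
    algebraMap V (FrobLayer φ i) = (incl φ i 0).comp (algebraMap V R) := rfl

variable (V)

/-- The transition map as a map of `V`-algebras. -/
def transAlgHom (i : ℕ) : FrobLayer φ i →ₐ[V] FrobLayer φ (i + 1) where
  __ := trans φ i
  commutes' v := by
    rw [algebraMap_eq, algebraMap_eq, ← trans_comp_incl φ i 0 (Nat.zero_le i)]
    rfl

end FrobLayer

/-- `Vᵢ = V[p^{1/pⁱ}]`, that is, `V[X] / (X ^ (p ^ i) - p)`. -/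
abbrev RootLayer (V : Type u) [CommRing V] (p i : ℕ) : Type u :=
  AdjoinRoot (Polynomial.X ^ p ^ i - Polynomial.C (p : V))

/-- The inclusion `V[p^{1/pⁱ}] → V[p^{1/pⁱ⁺¹}]`, sending `p^{1/pⁱ}` to `(p^{1/pⁱ⁺¹}) ^ p`. -/
noncomputable def RootLayer.trans (V : Type u) [CommRing V] (p i : ℕ) :
    RootLayer V p i →ₐ[V] RootLayer V p (i + 1) :=
  AdjoinRoot.liftAlgHom _ (Algebra.ofId V _) (AdjoinRoot.root _ ^ p) <| by
    have h := AdjoinRoot.eval₂_root (Polynomial.X ^ p ^ (i + 1) - Polynomial.C (p : V))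
    rw [Polynomial.eval₂_sub, Polynomial.eval₂_X_pow, Polynomial.eval₂_C] at h ⊢
    rw [← pow_mul, ← pow_succ']
    exact h

/-- The tower `R₀ ⊗_V V₀ → R₁ ⊗_V V₁ → R₂ ⊗_V V₂ → ⋯` of a `V`-algebra `R` with a ring
endomorphism `φ`. -/
noncomputable def tensorTower (V : Type u) [CommRing V] (p : ℕ) {R : Type u} [CommRing R]
    [Algebra V R] (φ : R →+* R) : RingTower.{u} where
  ring i := FrobLayer φ i ⊗[V] RootLayer V p i
  map i := (Algebra.TensorProduct.map (FrobLayer.transAlgHom φ V i)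
    (RootLayer.trans V p i)).toRingHom

/-- The canonical map from `R` to the bottom ring `(R₀ ⊗_V V₀)_red` of the reduced tower. -/
noncomputable def tensorTower.baseMap (V : Type u) [CommRing V] (p : ℕ) {R : Type u} [CommRing R]
    [Algebra V R] (φ : R →+* R) : R →+* (tensorTower V p φ).reduced.ring 0 :=
  (Ideal.Quotient.mk (nilradical (FrobLayer φ 0 ⊗[V] RootLayer V p 0))).comp
    ((Algebra.TensorProduct.includeLeftRingHom :
      FrobLayer φ 0 →+* FrobLayer φ 0 ⊗[V] RootLayer V p 0).comp (FrobLayer.incl φ 0 0))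

/-! ## `p`-derivations, stable ideals, and the Frobenius lift on `W(k)⟦x₂, …, x_d⟧` -/

/-- `δ` is a `p`-derivation on `A`. The last sum is `((x + y) ^ p - x ^ p - y ^ p) / p`. -/
structure IsPDerivation (p : ℕ) {A : Type u} [CommRing A] (δ : A → A) : Prop where
  map_zero : δ 0 = 0
  map_one : δ 1 = 0
  map_mul : ∀ x y, δ (x * y) = x ^ p * δ y + y ^ p * δ x + p * δ x * δ y
  map_add : ∀ x y, δ (x + y) = δ x + δ y -
    ∑ j ∈ Finset.Ioo 0 p, x ^ j * y ^ (p - j) * ((p.choose j / p : ℕ) : A)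

/-- An ideal is `φ`-stable if it contains `I^{[φ]}`, the ideal generated by `φ(I)`. -/
def IsPhiStable {A : Type u} [CommRing A] (φ : A →+* A) (I : Ideal A) : Prop :=
  I.map φ ≤ I

/-- The endomorphism of `A / I` induced by `φ` when `I` is `φ`-stable. -/
def IsPhiStable.quotMap {A : Type u} [CommRing A] {φ : A →+* A} {I : Ideal A}
    (h : IsPhiStable φ I) : A ⧸ I →+* A ⧸ I :=
  Ideal.quotientMap I φ (Ideal.map_le_iff_le_comap.mp h)

/-- `m` is a squarefree monomial in the elements `x j`. -/
def IsSquarefreeMonomial {A : Type u} [CommRing A] {ι : Type*} [Fintype ι] (x : ι → A)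
    (m : A) : Prop :=
  ∃ ε : ι → ℕ, (∀ j, ε j = 0 ∨ ε j = 1) ∧ m = ∏ j, x j ^ ε j

/-- `I` is generated by squarefree monomials in the elements `x j`. -/
def IsSquarefreeMonomialIdeal {A : Type u} [CommRing A] {ι : Type*} [Fintype ι] (x : ι → A)
    (I : Ideal A) : Prop :=
  ∃ M : Set A, (∀ m ∈ M, IsSquarefreeMonomial x m) ∧ I = Ideal.span M

theorem IsSquarefreeMonomialIdeal.isPhiStable {A : Type u} [CommRing A] {ι : Type*} [Fintype ι]
    {x : ι → A} {I : Ideal A} (hI : IsSquarefreeMonomialIdeal x I) {φ : A →+* A}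
    (hφ : ∀ j, x j ∣ φ (x j)) : IsPhiStable φ I := by
  obtain ⟨M, hM, rfl⟩ := hI
  unfold IsPhiStable
  rw [Ideal.map_span, Ideal.span_le]
  rintro _ ⟨m, hm, rfl⟩
  obtain ⟨ε, -, h⟩ := hM m hm
  have h1 : m ∣ φ m := by
    rw [h, map_prod]
    refine Finset.prod_dvd_prod_of_dvd _ _ fun j _ => ?_
    rw [map_pow]
    exact pow_dvd_pow_of_dvd (hφ j) _
  exact Ideal.mem_of_dvd _ h1 (Ideal.subset_span hm)

section PowerSeries

variable (p : ℕ) [hp : Fact p.Prime] (k : Type u) [Field k] (n : ℕ)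

/-- The ring `A = W(k)⟦x₂, …, x_d⟧`, with `n = d - 1` variables. -/
abbrev WittSeries : Type u := MvPowerSeries (Fin n) (WittVector p k)

/-- The elements `x₁ = p, x₂, …, x_d` of `A`. -/
noncomputable def wittParam : Fin (n + 1) → WittSeries p k n :=
  Fin.cons (p : WittSeries p k n) MvPowerSeries.X

/-- The endomorphism `φ` of `A` that is the Witt vector Frobenius on the coefficients and sends
each variable `x_j` to `x_j ^ p`. It is the Frobenius lift of a `p`-derivation which vanishes
on the variables, see `wittPhi_eq_frobeniusLift`. -/
noncomputable def wittPhi : WittSeries p k n →+* WittSeries p k n :=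
  (MvPowerSeries.map WittVector.frobenius).comp
    (MvPowerSeries.expand p hp.out.ne_zero : WittSeries p k n →ₐ[_] WittSeries p k n).toRingHom

theorem wittPhi_apply (f : WittSeries p k n) : wittPhi p k n f =
    MvPowerSeries.map WittVector.frobenius (MvPowerSeries.expand p hp.out.ne_zero f) := rfl

theorem wittPhi_C (a : WittVector p k) :
    wittPhi p k n (MvPowerSeries.C a) = MvPowerSeries.C (WittVector.frobenius a) := by
  rw [wittPhi_apply, MvPowerSeries.expand_C, MvPowerSeries.map_C]

theorem wittPhi_X (j : Fin n) :
    wittPhi p k n (MvPowerSeries.X j) = MvPowerSeries.X j ^ p := by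
  rw [wittPhi_apply, MvPowerSeries.expand_X, map_pow, MvPowerSeries.map_X]

theorem dvd_wittPhi_wittParam (j : Fin (n + 1)) :
    wittParam p k n j ∣ wittPhi p k n (wittParam p k n j) := by
  refine Fin.cases ?_ (fun j => ?_) j
  · simp [wittParam]
  · simp only [wittParam, Fin.cons_succ, wittPhi_X]
    exact dvd_pow_self _ hp.out.ne_zero

theorem dvd_wittPhi_sub_pow [CharP k p] [PerfectField k] (f : WittSeries p k n) :
    (p : WittSeries p k n) ∣ wittPhi p k n f - f ^ p := by
  have : ExpChar k p := ExpChar.prime hp.out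
  have : PerfectRing k p := PerfectField.toPerfectRing p
  set q : WittVector p k →+* k := WittVector.constantCoeff with hq
  have hfr : q.comp WittVector.frobenius = (frobenius k p).comp q := by
    ext a
    exact WittVector.coeff_frobenius_charP p a 0
  have h1 : MvPowerSeries.map q (wittPhi p k n f - f ^ p) = 0 := by
    rw [map_sub, map_pow, wittPhi_apply, ← RingHom.comp_apply, ← MvPowerSeries.map_comp, hfr,
      MvPowerSeries.map_comp, RingHom.comp_apply, MvPowerSeries.map_expand,
      MvPowerSeries.map_frobenius_expand, sub_self]
  have h2 : ∀ d, ∃ b : WittVector p k,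
      MvPowerSeries.coeff d (wittPhi p k n f - f ^ p) = p * b := by
    intro d
    have h3 : q (MvPowerSeries.coeff d (wittPhi p k n f - f ^ p)) = 0 := by
      rw [← MvPowerSeries.coeff_map, h1, map_zero]
    have h4 : MvPowerSeries.coeff d (wittPhi p k n f - f ^ p) ∈ RingHom.ker q := h3
    rw [hq, WittVector.ker_constantCoeff] at h4
    exact Ideal.mem_span_singleton.mp h4
  choose b hb using h2
  let g : WittSeries p k n := fun d => b d
  have hg : ∀ d, MvPowerSeries.coeff d g = b d := fun d => rfl
  refine ⟨g, ?_⟩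
  ext1 d
  rw [hb, ← map_natCast (MvPowerSeries.C : WittVector p k →+* WittSeries p k n),
    MvPowerSeries.coeff_C_mul, hg]

theorem wittPhi_eq_frobeniusLift [CharP k p] [PerfectField k] : ∃ δ : WittSeries p k n → WittSeries p k n,
    IsPDerivation p δ ∧ (∀ j, δ (MvPowerSeries.X j) = 0) ∧
      ∀ f, wittPhi p k n f = f ^ p + p * δ f := by
  choose δ hδ using dvd_wittPhi_sub_pow p k n
  have hδ' : ∀ f, wittPhi p k n f = f ^ p + p * δ f := fun f => by rw [← hδ]; ring
  have hp0 : (p : WittSeries p k n) ≠ 0 := by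
    rw [← map_natCast (MvPowerSeries.C : WittVector p k →+* WittSeries p k n)]
    intro h
    exact WittVector.p_nonzero p k (MvPowerSeries.C_injective (h.trans (map_zero _).symm))
  have inj : ∀ {a b : WittSeries p k n}, (p : WittSeries p k n) * a = p * b → a = b :=
    fun h => mul_left_cancel₀ hp0 h
  refine ⟨δ, ⟨?_, ?_, ?_, ?_⟩, ?_, hδ'⟩
  · apply inj
    rw [← hδ, map_zero, zero_pow hp.out.ne_zero]
    ring
  · apply inj
    rw [← hδ, map_one]
    ring
  · intro x y
    apply inj
    rw [← hδ, map_mul, hδ', hδ']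
    ring
  · intro x y
    apply inj
    rw [← hδ, map_add, hδ', hδ', add_pow_prime_eq' hp.out]
    ring
  · intro j
    apply inj
    rw [← hδ, wittPhi_X]
    ring

variable {p k n}

/-- The endomorphism of `R = A / I` induced by `φ`, for a squarefree monomial ideal `I`. -/
noncomputable def IsSquarefreeMonomialIdeal.phi {I : Ideal (WittSeries p k n)}
    (hI : IsSquarefreeMonomialIdeal (wittParam p k n) I) :
    WittSeries p k n ⧸ I →+* WittSeries p k n ⧸ I :=
  (hI.isPhiStable (dvd_wittPhi_wittParam p k n)).quotMap

end PowerSeries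

/-- The conditions on a ring `R` under which the reduced tower `(R ⊗ V[p^{1/pⁱ}])_red` can be
described explicitly: the rings `R / p` and `R / (R[p] + p R)` are reduced, `R` is `p`-adically
separated, its `p`-power torsion is killed by `p`, and `p` lies in the Jacobson radical. -/
structure IsPReducedBase (p : ℕ) (R : Type*) [CommRing R] : Prop where
  dvd_of_dvd_pow : ∀ (r : R) (N : ℕ), (p : R) ∣ r ^ N → (p : R) ∣ r
  exists_dvd_sub : ∀ (r s : R) (N : ℕ), (p : R) * s = 0 → (p : R) ∣ r ^ N - s →
    ∃ s' : R, (p : R) * s' = 0 ∧ (p : R) ∣ r - s'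
  separated : ∀ r : R, (∀ m : ℕ, (p : R) ^ m ∣ r) → r = 0
  mul_eq_zero : ∀ r : R, (p : R) * (p * r) = 0 → (p : R) * r = 0
  mem_jacobson : (p : R) ∈ Ideal.jacobson (⊥ : Ideal R)

/-- `T` is free over `R` with basis `1, y, …, y ^ (q - 1)`, and `y ^ q = p`. -/
structure IsRootExtension (p q : ℕ) {R T : Type*} [CommRing R] [CommRing T] (ι : R →+* T)
    (y : T) : Prop where
  pow_eq : y ^ q = p
  exists_sum : ∀ z : T, ∃ f : ℕ → R, z = ∑ j ∈ Finset.range q, ι (f j) * y ^ j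
  coeff_eq_zero : ∀ f : ℕ → R, ∑ j ∈ Finset.range q, ι (f j) * y ^ j = 0 → ∀ j < q, f j = 0

theorem natCast_mul_sum {R T : Type*} [CommRing R] [CommRing T] (ι : R →+* T)
    (y : T) (c : ℕ) (s : Finset ℕ) (f : ℕ → R) :
    (c : T) * ∑ j ∈ s, ι (f j) * y ^ j = ∑ j ∈ s, ι (c * f j) * y ^ j := by
  rw [Finset.mul_sum]
  refine Finset.sum_congr rfl fun j _ => ?_
  rw [map_mul, map_natCast, mul_assoc]

theorem sum_sub_sum_mul_pow {R T : Type*} [CommRing R] [CommRing T] (ι : R →+* T)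
    (y : T) (s : Finset ℕ) (f g : ℕ → R) :
    ∑ j ∈ s, ι (f j) * y ^ j - ∑ j ∈ s, ι (g j) * y ^ j = ∑ j ∈ s, ι (f j - g j) * y ^ j := by
  rw [← Finset.sum_sub_distrib]
  refine Finset.sum_congr rfl fun j _ => ?_
  rw [map_sub, sub_mul]

theorem dvd_sum_range_sub {R T : Type*} [CommRing R] [CommRing T] (ι : R →+* T)
    (y : T) {q : ℕ} (hq : 0 < q) (f : ℕ → R) :
    y ∣ ∑ j ∈ Finset.range q, ι (f j) * y ^ j - ι (f 0) := by
  obtain ⟨m, rfl⟩ := Nat.exists_eq_add_of_lt hq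
  rw [zero_add, Finset.sum_range_succ', pow_zero, mul_one, add_sub_cancel_right]
  exact Finset.dvd_sum fun j _ => Dvd.dvd.mul_left (dvd_pow_self _ j.succ_ne_zero) _

namespace IsRootExtension

variable {p q : ℕ} {R T : Type*} [CommRing R] [CommRing T] {ι : R →+* T} {y : T}

theorem natCast_eq (h : IsRootExtension p q ι y) (hq : 0 < q) : (p : T) = y * y ^ (q - 1) := by
  rw [← pow_succ', Nat.sub_add_cancel hq, h.pow_eq]

theorem dvd_of_dvd_map (h : IsRootExtension p q ι y) (hq : 0 < q) {r : R} (hr : y ∣ ι r) :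
    (p : R) ∣ r := by
  obtain ⟨z, hz⟩ := hr
  obtain ⟨f, rfl⟩ := h.exists_sum z
  obtain ⟨m, rfl⟩ := Nat.exists_eq_add_of_lt hq
  rw [zero_add] at *
  let g : ℕ → R := fun j => if j = 0 then r - p * f m else - f (j - 1)
  have hg : ∑ j ∈ Finset.range (m + 1), ι (g j) * y ^ j = 0 := by
    rw [Finset.sum_range_succ']
    simp only [g, if_true, Nat.succ_ne_zero, if_false, Nat.add_sub_cancel, map_sub, hz, map_mul,
      map_natCast, map_neg, Finset.sum_range_succ, ← h.pow_eq]
    rw [pow_succ, mul_add, add_sub_assoc]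
    have : ∀ j ∈ Finset.range m, -ι (f j) * y ^ (j + 1) = - (y * (ι (f j) * y ^ j)) :=
      fun j _ => by ring
    rw [Finset.sum_congr rfl this, Finset.sum_neg_distrib, ← Finset.mul_sum]
    ring
  have := h.coeff_eq_zero g hg 0 (by omega)
  simp only [g, if_true] at this
  exact ⟨f m, sub_eq_zero.mp this⟩

theorem coeff_natCast_mul_eq_zero (h : IsRootExtension p q ι y) (c : ℕ) (f : ℕ → R)
    (hf : (c : T) * ∑ j ∈ Finset.range q, ι (f j) * y ^ j = 0) (j : ℕ) (hj : j < q) :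
    (c : R) * f j = 0 := by
  rw [natCast_mul_sum] at hf
  exact h.coeff_eq_zero _ hf j hj

theorem mul_eq_zero_of_pow_mul (h : IsRootExtension p q ι y) (hR : IsPReducedBase p R) (m : ℕ)
    (z : T) (hz : (p : T) ^ m * (p * z) = 0) : (p : T) * z = 0 := by
  induction m with
  | zero => simpa using hz
  | succ m ih =>
    refine ih ?_
    obtain ⟨f, hf⟩ := h.exists_sum ((p : T) ^ m * z)
    have h1 : (p : T) ^ m * (p * z) = p * (p ^ m * z) := by ring
    have h2 : ((p * p : ℕ) : T) * (p ^ m * z) = 0 := by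
      rw [← hz]; push_cast; ring
    rw [hf] at h2
    rw [h1, hf, natCast_mul_sum]
    refine Finset.sum_eq_zero fun j hj => ?_
    have := h.coeff_natCast_mul_eq_zero _ f h2 j (Finset.mem_range.mp hj)
    rw [Nat.cast_mul, mul_assoc] at this
    rw [hR.mul_eq_zero _ this, map_zero, zero_mul]

theorem eq_zero_of_forall_pow_dvd (h : IsRootExtension p q ι y) (hR : IsPReducedBase p R) (z : T)
    (hz : ∀ m : ℕ, (p : T) ^ m ∣ z) : z = 0 := by
  obtain ⟨f, rfl⟩ := h.exists_sum z
  refine Finset.sum_eq_zero fun j hj => ?_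
  rw [hR.separated (f j), map_zero, zero_mul]
  intro m
  obtain ⟨w, hw⟩ := hz m
  obtain ⟨g, rfl⟩ := h.exists_sum w
  rw [← Nat.cast_pow, natCast_mul_sum, ← sub_eq_zero, sum_sub_sum_mul_pow] at hw
  refine ⟨g j, ?_⟩
  rw [← Nat.cast_pow]
  exact sub_eq_zero.mp (h.coeff_eq_zero _ hw j (Finset.mem_range.mp hj))

theorem exists_mul_eq (h : IsRootExtension p q ι y) (hq : 0 < q) (hR : IsPReducedBase p R)
    {z : T} {N : ℕ} (hz : (p : T) * z ^ N = 0) :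
    ∃ z' : T, (p : T) * z' ^ N = 0 ∧ (p : T) * z = y * (p * z') := by
  obtain ⟨f, hf⟩ := h.exists_sum z
  obtain ⟨g, hg⟩ := h.exists_sum (z ^ N)
  have hg0 : (p : R) * g 0 = 0 := by
    rw [hg] at hz
    exact h.coeff_natCast_mul_eq_zero p g hz 0 hq
  have h1 : y ∣ z - ι (f 0) := hf ▸ dvd_sum_range_sub ι y hq f
  have h2 : y ∣ z ^ N - ι (g 0) := hg ▸ dvd_sum_range_sub ι y hq g
  have h3 : y ∣ ι (f 0 ^ N - g 0) := by
    have h4 := (h1.trans (sub_dvd_pow_sub_pow z (ι (f 0)) N))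
    have h5 := dvd_sub h2 h4
    rw [map_sub, map_pow]
    convert h5 using 1
    ring
  obtain ⟨s, hs, c, hc⟩ := hR.exists_dvd_sub _ _ _ hg0 (h.dvd_of_dvd_map hq h3)
  obtain ⟨w, hw⟩ := h1
  have h6 := h.natCast_eq hq
  have hs' : (p : T) * ι s = 0 := by
    rw [← map_natCast ι, ← map_mul, hs, map_zero]
  have hz' : (p : T) * z = y * (p * (w + y ^ (q - 1) * ι c)) := by
    have h7 : z = ι s + p * ι c + y * w := by
      rw [← hw, ← map_natCast ι, ← map_mul, ← hc, map_sub]; ring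
    rw [h7, mul_add, mul_add, hs']
    linear_combination (p : T) * ι c * h6
  refine ⟨_, ?_, hz'⟩
  set z' := w + y ^ (q - 1) * ι c
  refine h.mul_eq_zero_of_pow_mul hR (N + N) _ ?_
  calc (p : T) ^ (N + N) * (p * z' ^ N)
      = (y ^ (q - 1)) ^ N * (y * (p * z')) ^ N * p := by
        rw [pow_add]
        nth_rw 1 [h6]
        simp only [mul_pow]
        ring
    _ = (y ^ (q - 1)) ^ N * p ^ N * (p * z ^ N) := by rw [← hz']; ring
    _ = 0 := by rw [hz, mul_zero]

theorem mul_eq_zero_of_mul_pow (h : IsRootExtension p q ι y) (hq : 0 < q)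
    (hR : IsPReducedBase p R) {z : T} {N : ℕ} (hz : (p : T) * z ^ N = 0) : (p : T) * z = 0 := by
  have key : ∀ m : ℕ, ∀ z : T, (p : T) * z ^ N = 0 → y ^ m ∣ p * z := by
    intro m
    induction m with
    | zero => intro z _; simp
    | succ m ih =>
      intro z hz
      obtain ⟨z', h1, h2⟩ := h.exists_mul_eq hq hR hz
      rw [h2, pow_succ']
      exact mul_dvd_mul_left _ (ih z' h1)
  refine h.eq_zero_of_forall_pow_dvd hR _ fun m => ?_
  have h1 := key (q * m) z hz
  rwa [pow_mul, h.pow_eq] at h1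

/-- The description of the nilradical in coordinates. -/
theorem coeff_of_isNilpotent (h : IsRootExtension p q ι y) (hq : 0 < q)
    (hR : IsPReducedBase p R) (f : ℕ → R)
    (hf : IsNilpotent (∑ j ∈ Finset.range q, ι (f j) * y ^ j)) :
    f 0 = 0 ∧ ∀ j < q, (p : R) * f j = 0 := by
  obtain ⟨N, hN⟩ := hf
  have h1 := h.mul_eq_zero_of_mul_pow hq hR (N := N) (by rw [hN, mul_zero])
  have h2 := h.coeff_natCast_mul_eq_zero p f h1
  refine ⟨?_, h2⟩
  have h3 := (dvd_sum_range_sub ι y hq f).trans (sub_dvd_pow_sub_pow _ _ N)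
  rw [hN, zero_sub, dvd_neg, ← map_pow] at h3
  obtain ⟨c, hc⟩ := hR.dvd_of_dvd_pow _ _ (h.dvd_of_dvd_map hq h3)
  have h4 := h2 0 hq
  rw [hc] at h4 ⊢
  exact hR.mul_eq_zero _ h4

end IsRootExtension

/-- A tower of reduced rings `Sᵢ` which are generated over `R` by a `pⁱ`-th root `yᵢ` of `p`,
where the only relations are those between `yᵢ` and the `p`-torsion of `R`. -/
structure IsReducedRootTower (p : ℕ) {R : Type u} [CommRing R] (φ : R →+* R) (T : RingTower.{u})
    (κ : ∀ i, R →+* T.ring i) (y : ∀ i, T.ring i) : Prop where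
  pow_eq : ∀ i, y i ^ p ^ i = p
  isReduced : ∀ i, IsReduced (T.ring i)
  exists_sum : ∀ i (z : T.ring i), ∃ f : ℕ → R,
    z = ∑ j ∈ Finset.range (p ^ i), κ i (f j) * y i ^ j
  coeff_eq_zero : ∀ i (f : ℕ → R), ∑ j ∈ Finset.range (p ^ i), κ i (f j) * y i ^ j = 0 →
    f 0 = 0 ∧ ∀ j < p ^ i, (p : R) * f j = 0
  map_base : ∀ i r, T.map i (κ i r) = κ (i + 1) (φ r)
  map_root : ∀ i, T.map i (y i) = y (i + 1) ^ p

namespace IsReducedRootTower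

variable {p : ℕ} {R : Type u} [CommRing R] {φ : R →+* R} {T : RingTower.{u}}
  {κ : ∀ i, R →+* T.ring i} {y : ∀ i, T.ring i}

theorem map_sum (h : IsReducedRootTower p φ T κ y) (i : ℕ) (s : Finset ℕ) (f : ℕ → R) :
    T.map i (∑ j ∈ s, κ i (f j) * y i ^ j) =
      ∑ j ∈ s, κ (i + 1) (φ (f j)) * y (i + 1) ^ (p * j) := by
  rw [_root_.map_sum]
  refine Finset.sum_congr rfl fun j _ => ?_
  rw [map_mul, map_pow, h.map_base, h.map_root, pow_mul]

theorem extIdeal_eq (T : RingTower.{u}) (e : R →+* T.ring 0) (i : ℕ) :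
    T.extIdeal e (Ideal.span {(p : R)}) i = Ideal.span {(p : T.ring i)} := by
  rw [RingTower.extIdeal, Ideal.map_span, Set.image_singleton, map_natCast]

theorem mk_eq_zero_iff (T : RingTower.{u}) (e : R →+* T.ring 0) (i : ℕ) (z : T.ring i) :
    Ideal.Quotient.mk (T.extIdeal e (Ideal.span {(p : R)}) i) z = 0 ↔ (p : T.ring i) ∣ z := by
  rw [Ideal.Quotient.eq_zero_iff_mem, extIdeal_eq, Ideal.mem_span_singleton]

theorem sum_range_mul (M : Type*) [AddCommMonoid M] (q : ℕ) (hp : 0 < p) (F : ℕ → M) :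
    ∑ j ∈ Finset.range q, F (p * j) =
      ∑ l ∈ Finset.range (p * q), if p ∣ l then F l else 0 := by
  rw [← Finset.sum_filter]
  refine Finset.sum_bij (fun j _ => p * j) ?_ ?_ ?_ ?_
  · intro j hj
    simp only [Finset.mem_filter, Finset.mem_range, dvd_mul_right, and_true] at hj ⊢
    exact Nat.mul_lt_mul_of_pos_left hj hp
  · intro a _ b _ hab
    exact Nat.eq_of_mul_eq_mul_left hp hab
  · rintro l hl
    simp only [Finset.mem_filter, Finset.mem_range] at hl
    obtain ⟨h1, j, rfl⟩ := hl
    exact ⟨j, Finset.mem_range.mpr (Nat.lt_of_mul_lt_mul_left h1), rfl⟩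
  · intro j _
    rfl

theorem quotMap_mk (T : RingTower.{u}) (e : R →+* T.ring 0) (I : Ideal R) (i : ℕ)
    (z : T.ring i) :
    T.quotMap e I i (Ideal.Quotient.mk _ z) = Ideal.Quotient.mk _ (T.map i z) := rfl

theorem fromFirst_root (h : IsReducedRootTower p φ T κ y) (i : ℕ) :
    T.fromFirst i (y 1) = y (i + 1) ^ p ^ i := by
  induction i with
  | zero => simp [RingTower.fromFirst]
  | succ i ih =>
    rw [RingTower.fromFirst, RingHom.comp_apply, ih, map_pow, h.map_root, ← pow_mul, ← pow_succ']

theorem mem_idealTorsion_iff (h : IsReducedRootTower p φ T κ y) (i : ℕ) (z : T.ring i) :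
    z ∈ idealTorsion (Ideal.span {(p : T.ring i)}) ↔ (p : T.ring i) * z = 0 := by
  constructor
  · rintro ⟨n, hn⟩
    have h1 := hn (p ^ n) (Ideal.pow_mem_pow (Ideal.mem_span_singleton_self _) n)
    have := h.isReduced i
    refine (pow_eq_zero_iff n.succ_ne_zero).mp ?_
    calc ((p : T.ring i) * z) ^ (n + 1) = p * z ^ n * (p ^ n * z) := by ring
      _ = 0 := by rw [h1, mul_zero]
  · intro hz
    refine ⟨1, fun a ha => ?_⟩
    rw [pow_one, Ideal.mem_span_singleton] at ha
    obtain ⟨b, rfl⟩ := ha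
    rw [mul_right_comm, hz, zero_mul]

variable [hp : Fact p.Prime]

theorem base_mul_root (h : IsReducedRootTower p φ T κ y) (i : ℕ) {r : R} (hr : (p : R) * r = 0) :
    κ i r * y i = 0 := by
  have := h.isReduced i
  have hq : 0 < p ^ i := pow_pos hp.out.pos i
  refine (pow_eq_zero_iff hq.ne').mp ?_
  rw [mul_pow, h.pow_eq, ← map_natCast (κ i), ← map_pow, ← map_mul,
    ← Nat.sub_add_cancel hq, pow_succ, mul_assoc, mul_comm r, hr, mul_zero, map_zero]

theorem dvd_sum (h : IsReducedRootTower p φ T κ y) (i : ℕ) (t : Finset ℕ) (f : ℕ → R)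
    (h0 : (p : R) ∣ f 0) (hf : ∀ j ∈ t, ∃ s : R, (p : R) * s = 0 ∧ (p : R) ∣ f j - s) :
    (p : T.ring i) ∣ ∑ j ∈ t, κ i (f j) * y i ^ j := by
  obtain ⟨c, hc⟩ := h0
  refine Finset.dvd_sum fun j hj => ?_
  obtain ⟨s, hs, d, hd⟩ := hf j hj
  rcases j with _ | j
  · exact ⟨κ i c, by rw [hc, map_mul, map_natCast, pow_zero, mul_one]⟩
  · refine ⟨κ i d * y i ^ (j + 1), ?_⟩
    rw [← sub_add_cancel (f (j + 1)) s, hd, map_add, add_mul, pow_succ' (y i) j,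
      ← mul_assoc (κ i s), h.base_mul_root i hs, map_mul, map_natCast]
    ring

theorem dvd_sum_iff (h : IsReducedRootTower p φ T κ y) (i : ℕ) (f : ℕ → R) :
    (p : T.ring i) ∣ ∑ j ∈ Finset.range (p ^ i), κ i (f j) * y i ^ j ↔
      (p : R) ∣ f 0 ∧ ∀ j < p ^ i, ∃ s : R, (p : R) * s = 0 ∧ (p : R) ∣ f j - s := by
  constructor
  · rintro ⟨w, hw⟩
    obtain ⟨g, rfl⟩ := h.exists_sum i w
    rw [natCast_mul_sum, ← sub_eq_zero, sum_sub_sum_mul_pow] at hw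
    obtain ⟨h1, h2⟩ := h.coeff_eq_zero i _ hw
    refine ⟨⟨g 0, sub_eq_zero.mp h1⟩, fun j hj => ⟨f j - p * g j, h2 j hj, g j, by ring⟩⟩
  · rintro ⟨hc, h2⟩
    exact h.dvd_sum i _ f hc fun j hj => h2 j (Finset.mem_range.mp hj)

theorem dvd_of_dvd_map (h : IsReducedRootTower p φ T κ y) (hR : IsPReducedBase p R)
    (hφ : ∀ r, (p : R) ∣ φ r - r ^ p) (i : ℕ) (z : T.ring i)
    (hz : (p : T.ring (i + 1)) ∣ T.map i z) : (p : T.ring i) ∣ z := by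
  obtain ⟨f, rfl⟩ := h.exists_sum i z
  have hpp := hp.out.pos
  have hφ' : ∀ r, (p : R) ∣ r ^ p - φ r := fun r => (dvd_sub_comm).mp (hφ r)
  have h0 : ∑ j ∈ Finset.range (p ^ i), κ (i + 1) (φ (f j)) * y (i + 1) ^ (p * j) =
      ∑ l ∈ Finset.range (p ^ (i + 1)),
        κ (i + 1) (if p ∣ l then φ (f (l / p)) else 0) * y (i + 1) ^ l := by
    have := sum_range_mul (p := p) _ (p ^ i) hpp
      (fun l => κ (i + 1) (φ (f (l / p))) * y (i + 1) ^ l)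
    simp only [Nat.mul_div_cancel_left _ hpp] at this
    rw [this, pow_succ']
    refine Finset.sum_congr rfl fun l _ => ?_
    split_ifs <;> simp
  rw [h.map_sum, h0, h.dvd_sum_iff] at hz
  rw [h.dvd_sum_iff]
  obtain ⟨h1, h2⟩ := hz
  simp only [dvd_zero, if_true, Nat.zero_div] at h1
  refine ⟨hR.dvd_of_dvd_pow _ p ?_, fun j hj => ?_⟩
  · have := dvd_add (hφ' (f 0)) h1
    rwa [sub_add_cancel] at this
  · obtain ⟨s, hs, h3⟩ := h2 (p * j) (by rw [pow_succ']; exact Nat.mul_lt_mul_of_pos_left hj hpp)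
    rw [if_pos (dvd_mul_right p j), Nat.mul_div_cancel_left _ hpp] at h3
    refine hR.exists_dvd_sub (f j) s p hs ?_
    have := dvd_add (hφ' (f j)) h3
    rwa [sub_add_sub_cancel] at this

theorem mk_sum_pow (h : IsReducedRootTower p φ T κ y)
    (hφ : ∀ r, (p : R) ∣ φ r - r ^ p) (e : R →+* T.ring 0) (i : ℕ) (s : Finset ℕ) (f : ℕ → R) :
    T.quotMap e (Ideal.span {(p : R)}) i
        (Ideal.Quotient.mk _ (∑ j ∈ s, κ i (f j) * y i ^ j)) =
      Ideal.Quotient.mk _ (∑ j ∈ s, κ (i + 1) (f j) * y (i + 1) ^ j) ^ p := by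
  set Q := T.ring (i + 1) ⧸ T.extIdeal e (Ideal.span {(p : R)}) (i + 1)
  have hpQ : ((p : ℕ) : Q) = 0 := by
    have := (mk_eq_zero_iff T e (i + 1) (p : T.ring (i + 1))).mpr dvd_rfl
    rwa [map_natCast] at this
  rw [quotMap_mk, h.map_sum, _root_.map_sum, _root_.map_sum]
  have hadd : ∀ a b : Q, (a + b) ^ p = a ^ p + b ^ p := fun a b => by
    rw [add_pow_prime_eq' hp.out, hpQ, zero_mul, add_zero]
  let F : Q →+ Q :=
    { toFun := fun a => a ^ p, map_zero' := zero_pow hp.out.ne_zero, map_add' := hadd }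
  change _ = F _
  rw [_root_.map_sum F]
  refine Finset.sum_congr rfl fun j _ => ?_
  change _ = (Ideal.Quotient.mk _ _) ^ p
  rw [← map_pow, ← sub_eq_zero, ← map_sub, mk_eq_zero_iff, mul_pow, ← pow_mul, mul_comm j p,
    ← sub_mul, ← map_pow, ← map_sub]
  have := map_dvd (κ (i + 1)) (hφ (f j))
  rw [map_natCast] at this
  exact this.mul_right _

theorem isPurelyInseparable (h : IsReducedRootTower p φ T κ y) (hR : IsPReducedBase p R)
    (hφ : ∀ r, (p : R) ∣ φ r - r ^ p) :
    T.IsPurelyInseparable p (κ 0) (Ideal.span {(p : R)}) where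
  base_bijective := by
    constructor
    · rw [injective_iff_map_eq_zero]
      intro r hr
      exact (h.coeff_eq_zero 0 (fun _ => r) (by simpa using hr)).1
    · intro z
      obtain ⟨f, rfl⟩ := h.exists_sum 0 z
      exact ⟨f 0, by simp⟩
  p_mem := Ideal.mem_span_singleton_self _
  quotMap_injective i := by
    rw [injective_iff_map_eq_zero]
    intro x hx
    obtain ⟨z, rfl⟩ := Ideal.Quotient.mk_surjective x
    rw [quotMap_mk, mk_eq_zero_iff] at hx
    rw [mk_eq_zero_iff]
    exact h.dvd_of_dvd_map hR hφ i z hx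
  pow_mem_range i x := by
    obtain ⟨z, rfl⟩ := Ideal.Quotient.mk_surjective x
    obtain ⟨f, rfl⟩ := h.exists_sum (i + 1) z
    exact ⟨_, h.mk_sum_pow hφ (κ 0) i _ f⟩

theorem frobProj_mk_sum (h : IsReducedRootTower p φ T κ y) (hφ : ∀ r, (p : R) ∣ φ r - r ^ p)
    (hT : T.IsPurelyInseparable p (κ 0) (Ideal.span {(p : R)})) (i : ℕ) (s : Finset ℕ)
    (f : ℕ → R) :
    hT.frobProj i (Ideal.Quotient.mk _ (∑ j ∈ s, κ (i + 1) (f j) * y (i + 1) ^ j)) =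
      Ideal.Quotient.mk _ (∑ j ∈ s, κ i (f j) * y i ^ j) := by
  refine hT.quotMap_injective i ?_
  rw [hT.quotMap_frobProj, h.mk_sum_pow hφ]

theorem frobProj_mk_base (h : IsReducedRootTower p φ T κ y) (hφ : ∀ r, (p : R) ∣ φ r - r ^ p)
    (hT : T.IsPurelyInseparable p (κ 0) (Ideal.span {(p : R)})) (i : ℕ) (r : R) :
    hT.frobProj i (Ideal.Quotient.mk _ (κ (i + 1) r)) = Ideal.Quotient.mk _ (κ i r) := by
  have := h.frobProj_mk_sum hφ hT i {0} (fun _ => r)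
  simpa using this

theorem base_isIntegral (h : IsReducedRootTower p φ T κ y) (i : ℕ) : (κ i).IsIntegral := by
  intro z
  obtain ⟨f, rfl⟩ := h.exists_sum i z
  have hq : p ^ i ≠ 0 := (pow_pos hp.out.pos i).ne'
  have hy : (κ i).IsIntegralElem (y i) :=
    ⟨Polynomial.X ^ p ^ i - Polynomial.C (p : R), Polynomial.monic_X_pow_sub_C _ hq, by
      rw [Polynomial.eval₂_sub, Polynomial.eval₂_X_pow, Polynomial.eval₂_C, map_natCast,
        h.pow_eq, sub_self]⟩
  let _ : Algebra R (T.ring i) := (κ i).toAlgebra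
  have hy' : IsIntegral R (y i) := hy
  exact IsIntegral.sum _ fun j _ => (isIntegral_algebraMap (x := f j)).mul (hy'.pow j)

theorem span_le_jacobson (h : IsReducedRootTower p φ T κ y) (hR : IsPReducedBase p R) (i : ℕ) :
    Ideal.span {(p : T.ring i)} ≤ Ideal.jacobson ⊥ := by
  rw [Ideal.span_singleton_le_iff_mem, Ideal.jacobson, Ideal.mem_sInf]
  rintro m ⟨-, hm⟩
  have h1 := Ideal.isMaximal_comap_of_isIntegral_of_isMaximal' (κ i) (h.base_isIntegral i) m
  have h2 := hR.mem_jacobson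
  rw [Ideal.jacobson, Ideal.mem_sInf] at h2
  have h3 := h2 ⟨bot_le, h1⟩
  rwa [Ideal.mem_comap, map_natCast] at h3

theorem mul_eq_zero_iff (h : IsReducedRootTower p φ T κ y) (hR : IsPReducedBase p R) (i : ℕ)
    (z : T.ring i) : (p : T.ring i) * z = 0 ↔ ∃ r : R, (p : R) * r = 0 ∧ κ i r = z := by
  constructor
  · intro hz
    obtain ⟨f, rfl⟩ := h.exists_sum i z
    have hz' := hz
    rw [natCast_mul_sum] at hz
    obtain ⟨h1, h2⟩ := h.coeff_eq_zero i _ hz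
    refine ⟨f 0, h1, ?_⟩
    rw [Finset.sum_eq_single_of_mem 0 (Finset.mem_range.mpr (pow_pos hp.out.pos i)), pow_zero,
      mul_one]
    intro j hj hj0
    obtain ⟨m, rfl⟩ := Nat.exists_eq_succ_of_ne_zero hj0
    rw [Nat.succ_eq_add_one, pow_succ', ← mul_assoc,
      h.base_mul_root i (hR.mul_eq_zero _ (h2 _ (Finset.mem_range.mp hj))), zero_mul]
  · rintro ⟨r, hr, rfl⟩
    rw [← map_natCast (κ i), ← map_mul, hr, map_zero]

theorem base_injective (h : IsReducedRootTower p φ T κ y) (i : ℕ) :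
    Function.Injective (κ i) := by
  rw [injective_iff_map_eq_zero]
  intro r hr
  refine (h.coeff_eq_zero i (fun j => if j = 0 then r else 0) ?_).1
  rw [Finset.sum_eq_single_of_mem 0 (Finset.mem_range.mpr (pow_pos hp.out.pos i))]
  · simpa using hr
  · intro j _ hj0
    simp [hj0]

theorem exists_torsion_bijection (h : IsReducedRootTower p φ T κ y) (hR : IsPReducedBase p R)
    (i : ℕ) :
    ∃ G : idealTorsion (Ideal.span {(p : T.ring (i + 1))}) →
        idealTorsion (Ideal.span {(p : T.ring i)}),
      Function.Bijective G ∧ ∀ x : idealTorsion (Ideal.span {(p : T.ring (i + 1))}),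
        ∃ r : R, κ (i + 1) r = x ∧ κ i r = G x := by
  have h1 : ∀ j (x : idealTorsion (Ideal.span {(p : T.ring j)})),
      ∃ r : R, (p : R) * r = 0 ∧ κ j r = x := fun j x =>
    (h.mul_eq_zero_iff hR j _).mp ((h.mem_idealTorsion_iff j _).mp x.2)
  have h2 : ∀ j (r : R), (p : R) * r = 0 → κ j r ∈ idealTorsion (Ideal.span {(p : T.ring j)}) :=
    fun j r hr => (h.mem_idealTorsion_iff j _).mpr ((h.mul_eq_zero_iff hR j _).mpr ⟨r, hr, rfl⟩)
  choose g hg hg' using h1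
  refine ⟨fun x => ⟨κ i (g (i + 1) x), h2 i _ (hg _ x)⟩, ⟨?_, ?_⟩, ?_⟩
  · intro a b hab
    have h3 := h.base_injective i (congrArg Subtype.val hab)
    refine Subtype.ext ?_
    rw [← hg', ← hg', h3]
  · intro x
    refine ⟨⟨κ (i + 1) (g i x), h2 _ _ (hg _ x)⟩, Subtype.ext ?_⟩
    have h3 := h.base_injective (i + 1)
      (hg' (i + 1) ⟨κ (i + 1) (g i x), h2 _ _ (hg _ x)⟩)
    exact (congrArg (κ i) h3).trans (hg' i x)
  · exact fun x => ⟨g (i + 1) x, hg' _ x, rfl⟩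

theorem ker_frobProj (h : IsReducedRootTower p φ T κ y) (hφ : ∀ r, (p : R) ∣ φ r - r ^ p)
    (hT : T.IsPurelyInseparable p (κ 0) (Ideal.span {(p : R)})) (i : ℕ) :
    RingHom.ker (hT.frobProj i) = ((Ideal.span {y 1}).map (T.fromFirst i)).map
      (Ideal.Quotient.mk (T.extIdeal (κ 0) (Ideal.span {(p : R)}) (i + 1))) := by
  have hle : p ^ i ≤ p ^ (i + 1) := Nat.pow_le_pow_right hp.out.pos i.le_succ
  rw [Ideal.map_span, Set.image_singleton, Ideal.map_span, Set.image_singleton,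
    h.fromFirst_root]
  apply le_antisymm
  · intro x hx
    obtain ⟨z, rfl⟩ := Ideal.Quotient.mk_surjective x
    obtain ⟨f, rfl⟩ := h.exists_sum (i + 1) z
    have h1 : ∀ l, (∑ j ∈ Finset.range (p ^ (i + 1)), κ l (f j) * y l ^ j) =
        (∑ j ∈ Finset.range (p ^ i), κ l (f j) * y l ^ j) +
        y l ^ p ^ i * ∑ j ∈ Finset.Ico (p ^ i) (p ^ (i + 1)), κ l (f j) * y l ^ (j - p ^ i) := by
      intro l
      rw [← Finset.sum_range_add_sum_Ico _ hle, Finset.mul_sum]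
      congr 1
      refine Finset.sum_congr rfl fun j hj => ?_
      rw [mul_left_comm, ← pow_add, Nat.add_sub_cancel' (Finset.mem_Ico.mp hj).1]
    rw [RingHom.mem_ker, h.frobProj_mk_sum hφ hT, mk_eq_zero_iff, h1, h.pow_eq,
      (dvd_add_left (dvd_mul_right _ _)), h.dvd_sum_iff] at hx
    rw [h1, map_add, Ideal.mem_span_singleton]
    refine dvd_add ?_ (map_dvd _ (dvd_mul_right _ _))
    have h2 := h.dvd_sum (i + 1) _ f hx.1 fun j hj => hx.2 j (Finset.mem_range.mp hj)
    rw [(mk_eq_zero_iff T (κ 0) (i + 1) _).mpr h2]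
    exact dvd_zero _
  · rw [Ideal.span_singleton_le_iff_mem, RingHom.mem_ker]
    have := h.frobProj_mk_sum hφ hT i {p ^ i} (fun _ => 1)
    simp only [Finset.sum_singleton, map_one, one_mul] at this
    rw [this, mk_eq_zero_iff, h.pow_eq]

theorem isPerfectoid (h : IsReducedRootTower p φ T κ y) (hR : IsPReducedBase p R)
    (hφ : ∀ r, (p : R) ∣ φ r - r ^ p) :
    T.IsPerfectoid p (κ 0) (Ideal.span {(p : R)}) where
  __ := h.isPurelyInseparable hR hφ
  frobProj_surjective i x := by
    obtain ⟨z, rfl⟩ := Ideal.Quotient.mk_surjective x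
    obtain ⟨f, rfl⟩ := h.exists_sum i z
    exact ⟨_, h.frobProj_mk_sum hφ _ i _ f⟩
  zariskian i := by
    rw [extIdeal_eq]
    exact h.span_le_jacobson hR i
  isPrincipal := ⟨⟨_, rfl⟩⟩
  exists_pillar := by
    refine ⟨Ideal.span {y 1}, ⟨⟨_, rfl⟩⟩, ?_, h.ker_frobProj hφ _⟩
    have := h.pow_eq 1
    rw [pow_one] at this
    rw [Ideal.span_singleton_pow, extIdeal_eq, this]
  mul_torsion i a ha x hx := by
    rw [extIdeal_eq] at ha hx
    rw [h.mem_idealTorsion_iff] at hx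
    obtain ⟨b, rfl⟩ := Ideal.mem_span_singleton.mp ha
    rw [mul_right_comm, hx, zero_mul]
  exists_torsion_bijection i := by
    have h1 := h.exists_torsion_bijection hR i
    rw [← extIdeal_eq T (κ 0) i, ← extIdeal_eq T (κ 0) (i + 1)] at h1
    obtain ⟨G, hG, hG'⟩ := h1
    refine ⟨G, hG, fun x => ?_⟩
    obtain ⟨r, h2, h3⟩ := hG' x
    rw [← h2, ← h3]
    exact h.frobProj_mk_base hφ _ i r

theorem exists_mul_eq_zero_iff (h : IsReducedRootTower p φ T κ y) (hR : IsPReducedBase p R)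
    (i : ℕ) : (∃ s : T.ring i, s ≠ 0 ∧ (p : T.ring i) * s = 0) ↔
      ∃ r : R, r ≠ 0 ∧ (p : R) * r = 0 := by
  constructor
  · rintro ⟨s, hs, h1⟩
    obtain ⟨r, hr, rfl⟩ := (h.mul_eq_zero_iff hR i s).mp h1
    exact ⟨r, fun h2 => hs (by rw [h2, map_zero]), hr⟩
  · rintro ⟨r, hr, h1⟩
    exact ⟨κ i r, fun h2 => hr (h.base_injective i (h2.trans (map_zero _).symm)),
      (h.mul_eq_zero_iff hR i _).mpr ⟨r, h1, rfl⟩⟩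

end IsReducedRootTower

namespace RingTower

/-- The projection to the reduced tower. -/
noncomputable def toReduced (T : RingTower.{u}) (i : ℕ) : T.ring i →+* T.reduced.ring i :=
  Ideal.Quotient.mk (nilradical (T.ring i))

variable (T : RingTower.{u})

theorem toReduced_surjective (i : ℕ) : Function.Surjective (T.toReduced i) :=
  Ideal.Quotient.mk_surjective

theorem toReduced_eq_zero_iff (i : ℕ) (z : T.ring i) :
    T.toReduced i z = 0 ↔ IsNilpotent z :=
  Ideal.Quotient.eq_zero_iff_mem.trans mem_nilradical

theorem reduced_map_toReduced (i : ℕ) (z : T.ring i) :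
    T.reduced.map i (T.toReduced i z) = T.toReduced (i + 1) (T.map i z) := rfl

theorem isReduced_reduced (i : ℕ) : IsReduced (T.reduced.ring i) :=
  (Ideal.isRadical_iff_quotient_reduced _).mp (Ideal.radical_isRadical (⊥ : Ideal (T.ring i)))

variable {T} in
theorem isReducedRootTower_reduced {p : ℕ} [hp : Fact p.Prime] {R : Type u} [CommRing R]
    {φ : R →+* R} {κ : ∀ i, R →+* T.ring i} {y : ∀ i, T.ring i} (hR : IsPReducedBase p R)
    (hT : ∀ i, IsRootExtension p (p ^ i) (κ i) (y i))
    (hκ : ∀ i r, T.map i (κ i r) = κ (i + 1) (φ r)) (hy : ∀ i, T.map i (y i) = y (i + 1) ^ p) :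
    IsReducedRootTower p φ T.reduced (fun i => (T.toReduced i).comp (κ i))
      (fun i => T.toReduced i (y i)) where
  pow_eq i := by rw [← map_pow, (hT i).pow_eq, map_natCast]
  isReduced := T.isReduced_reduced
  exists_sum i z := by
    obtain ⟨w, rfl⟩ := T.toReduced_surjective i z
    obtain ⟨f, rfl⟩ := (hT i).exists_sum w
    exact ⟨f, by simp only [map_sum, map_mul, map_pow, RingHom.comp_apply]⟩
  coeff_eq_zero i f hf := by
    refine (hT i).coeff_of_isNilpotent (pow_pos hp.out.pos i) hR f ?_
    rw [← toReduced_eq_zero_iff, ← hf]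
    simp only [map_sum, map_mul, map_pow, RingHom.comp_apply]
  map_base i r := by
    rw [RingHom.comp_apply, reduced_map_toReduced, hκ, RingHom.comp_apply]
  map_root i := by rw [reduced_map_toReduced, hy, map_pow]

end RingTower

namespace tensorTower

variable (V : Type u) [CommRing V] (p : ℕ) {R : Type u} [CommRing R] [Algebra V R] (φ : R →+* R)

/-- The map `r ↦ r ⊗ 1` from the last copy of `R`. -/
noncomputable def base (i : ℕ) : R →+* FrobLayer φ i ⊗[V] RootLayer V p i :=
  (Algebra.TensorProduct.includeLeftRingHom :
    FrobLayer φ i →+* FrobLayer φ i ⊗[V] RootLayer V p i).comp (FrobLayer.last φ i : R →+* _)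

/-- The element `1 ⊗ p ^ {1 / pⁱ}`. -/
noncomputable def root (i : ℕ) : FrobLayer φ i ⊗[V] RootLayer V p i :=
  (Algebra.TensorProduct.includeRight : RootLayer V p i →ₐ[V] _) (AdjoinRoot.root _)

theorem map_base (i : ℕ) (r : R) :
    Algebra.TensorProduct.map (FrobLayer.transAlgHom φ V i) (RootLayer.trans V p i)
      (base V p φ i r) = base V p φ (i + 1) (φ r) := by
  change Algebra.TensorProduct.map _ _ (FrobLayer.last φ i r ⊗ₜ 1) =
    FrobLayer.last φ (i + 1) (φ r) ⊗ₜ 1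
  rw [Algebra.TensorProduct.map_tmul, map_one]
  rfl

theorem map_root (i : ℕ) :
    Algebra.TensorProduct.map (FrobLayer.transAlgHom φ V i) (RootLayer.trans V p i)
      (root V p φ i) = root V p φ (i + 1) ^ p := by
  rw [root, root, ← map_pow, Algebra.TensorProduct.includeRight_apply,
    Algebra.TensorProduct.map_tmul, map_one, RootLayer.trans, AdjoinRoot.liftAlgHom_root]
  rfl

theorem base_mul_root_pow (i : ℕ) (r : R) (j : ℕ) :
    base V p φ i r * root V p φ i ^ j =
      FrobLayer.last φ i r ⊗ₜ[V] (AdjoinRoot.root _ ^ j : RootLayer V p i) := by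
  rw [root, ← map_pow, Algebra.TensorProduct.includeRight_apply]
  change (FrobLayer.last φ i r ⊗ₜ[V] 1) * _ = _
  rw [Algebra.TensorProduct.tmul_mul_tmul, mul_one, one_mul]

theorem isRootExtension [hp : Fact p.Prime] [Nontrivial V] (i : ℕ) :
    IsRootExtension p (p ^ i) (base V p φ i) (root V p φ i) := by
  have hq : p ^ i ≠ 0 := (pow_pos hp.out.pos i).ne'
  have hm : (Polynomial.X ^ p ^ i - Polynomial.C (p : V)).Monic :=
    Polynomial.monic_X_pow_sub_C _ hq
  let b := Algebra.TensorProduct.basis (FrobLayer φ i) (AdjoinRoot.powerBasis' hm).basis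
  have hd : (AdjoinRoot.powerBasis' hm).dim = p ^ i := by
    rw [AdjoinRoot.powerBasis'_dim, Polynomial.natDegree_X_pow_sub_C]
  have hb : ∀ f : ℕ → R, ∑ j ∈ Finset.range (p ^ i), base V p φ i (f j) * root V p φ i ^ j =
      ∑ j : Fin (AdjoinRoot.powerBasis' hm).dim, FrobLayer.last φ i (f j) • b j := by
    intro f
    refine (Finset.sum_congr (congrArg Finset.range hd.symm) fun _ _ => rfl).trans ?_
    rw [Finset.sum_range]
    refine Finset.sum_congr rfl fun j _ => ?_
    rw [Algebra.TensorProduct.basis_apply, PowerBasis.basis_eq_pow, AdjoinRoot.powerBasis'_gen,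
      base_mul_root_pow, TensorProduct.smul_tmul', smul_eq_mul, mul_one]
  constructor
  · have h := AdjoinRoot.eval₂_root (Polynomial.X ^ p ^ i - Polynomial.C (p : V))
    rw [Polynomial.eval₂_sub, Polynomial.eval₂_X_pow, Polynomial.eval₂_C, sub_eq_zero] at h
    rw [root, ← map_pow, h, map_natCast (AdjoinRoot.of _) p]
    exact map_natCast Algebra.TensorProduct.includeRight p
  · intro z
    refine ⟨fun j => if hj : j < _ then (FrobLayer.last φ i).symm (b.repr z ⟨j, hj⟩) else 0, ?_⟩
    rw [hb]
    refine (b.sum_repr z).symm.trans (Finset.sum_congr rfl fun j _ => ?_)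
    rw [dif_pos j.2, RingEquiv.apply_symm_apply]
  · intro f hf j hj
    rw [hb] at hf
    have h := (Fintype.linearIndependent_iff.mp b.linearIndependent) _ hf ⟨j, hj.trans_eq hd.symm⟩
    exact (FrobLayer.last φ i).injective (h.trans (map_zero _).symm)

theorem isReducedRootTower [hp : Fact p.Prime] [Nontrivial V] (hR : IsPReducedBase p R) :
    IsReducedRootTower p φ (tensorTower V p φ).reduced
      (fun i => ((tensorTower V p φ).toReduced i).comp (base V p φ i))
      (fun i => (tensorTower V p φ).toReduced i (root V p φ i)) :=
  RingTower.isReducedRootTower_reduced hR (isRootExtension V p φ) (map_base V p φ)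
    (map_root V p φ)

theorem isPerfectoid [hp : Fact p.Prime] [Nontrivial V] (hR : IsPReducedBase p R)
    (hφ : ∀ r, (p : R) ∣ φ r - r ^ p) :
    (tensorTower V p φ).reduced.IsPerfectoid p (baseMap V p φ) (Ideal.span {(p : R)}) :=
  (isReducedRootTower V p φ hR).isPerfectoid hR hφ

end tensorTower

namespace MvPowerSeries

section SupportIdeal

variable {σ W : Type*} [CommRing W]

/-- The power series with given coefficients. -/
def ofCoeff (a : (σ →₀ ℕ) → W) : MvPowerSeries σ W := a

theorem coeff_ofCoeff (a : (σ →₀ ℕ) → W) (α : σ →₀ ℕ) : coeff α (ofCoeff a) = a α := rfl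

theorem antidiagonal_fst_le [DecidableEq σ] {α : σ →₀ ℕ} {β : (σ →₀ ℕ) × (σ →₀ ℕ)}
    (h : β ∈ Finset.HasAntidiagonal.antidiagonal α) : β.1 ≤ α :=
  Finset.HasAntidiagonal.mem_antidiagonal.mp h ▸ le_self_add

theorem antidiagonal_snd_le [DecidableEq σ] {α : σ →₀ ℕ} {β : (σ →₀ ℕ) × (σ →₀ ℕ)}
    (h : β ∈ Finset.HasAntidiagonal.antidiagonal α) : β.2 ≤ α :=
  Finset.HasAntidiagonal.mem_antidiagonal.mp h ▸ le_add_self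

/-- The ideal of the power series whose coefficient at each `α` lies in `J (supp α)`. -/
def supportIdeal (J : Finset σ → Ideal W) (hJ : Monotone J) : Ideal (MvPowerSeries σ W) where
  carrier := {f | ∀ α, coeff α f ∈ J α.support}
  zero_mem' α := by rw [map_zero]; exact zero_mem _
  add_mem' hf hg α := by rw [map_add]; exact add_mem (hf α) (hg α)
  smul_mem' c f hf α := by
    classical
    rw [smul_eq_mul, coeff_mul]
    refine sum_mem fun β hβ => Ideal.mul_mem_left _ _ (hJ (Finsupp.support_mono ?_) (hf _))
    exact antidiagonal_snd_le hβ

theorem mem_supportIdeal {J : Finset σ → Ideal W} {hJ : Monotone J} {f : MvPowerSeries σ W} :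
    f ∈ supportIdeal J hJ ↔ ∀ α, coeff α f ∈ J α.support := Iff.rfl

open Classical in
/-- The endomorphism which sends the variables outside of `S` to `0`. -/
noncomputable def restrict (S : Finset σ) : MvPowerSeries σ W →+* MvPowerSeries σ W where
  toFun f := ofCoeff fun α => if α.support ⊆ S then coeff α f else 0
  map_zero' := by
    ext α
    rw [coeff_ofCoeff, map_zero, ite_self]
  map_one' := by
    ext α
    rw [coeff_ofCoeff, coeff_one]
    split_ifs <;> simp_all
  map_add' f g := by
    ext α
    simp only [map_add, coeff_ofCoeff]
    split_ifs <;> simp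
  map_mul' f g := by
    ext α
    rw [coeff_mul, coeff_ofCoeff]
    simp only [coeff_ofCoeff]
    split_ifs with h
    · rw [coeff_mul]
      refine Finset.sum_congr rfl fun β hβ => ?_
      rw [if_pos ((Finsupp.support_mono (antidiagonal_fst_le hβ)).trans h),
        if_pos ((Finsupp.support_mono (antidiagonal_snd_le hβ)).trans h)]
    · refine (Finset.sum_eq_zero fun β hβ => ?_).symm
      by_cases h1 : β.1.support ⊆ S
      · rw [if_neg (c := β.2.support ⊆ S), mul_zero]
        intro h2
        refine h ?_
        rw [← Finset.HasAntidiagonal.mem_antidiagonal.mp hβ]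
        exact Finsupp.support_add.trans (Finset.union_subset h1 h2)
      · rw [if_neg h1, zero_mul]

open Classical in
theorem coeff_restrict (S : Finset σ) (f : MvPowerSeries σ W) (α : σ →₀ ℕ) :
    coeff α (restrict S f) = if α.support ⊆ S then coeff α f else 0 := rfl

theorem mem_supportIdeal_iff_restrict {J : Finset σ → Ideal W} {hJ : Monotone J}
    {f : MvPowerSeries σ W} :
    f ∈ supportIdeal J hJ ↔ ∀ S, map (Ideal.Quotient.mk (J S)) (restrict S f) = 0 := by
  classical
  constructor
  · intro hf S
    ext α
    rw [coeff_map, coeff_restrict, map_zero, Ideal.Quotient.eq_zero_iff_mem]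
    split_ifs with h
    · exact hJ h (hf α)
    · exact zero_mem _
  · intro hf α
    have := congrArg (coeff α) (hf α.support)
    rwa [coeff_map, coeff_restrict, if_pos subset_rfl, map_zero,
      Ideal.Quotient.eq_zero_iff_mem] at this

theorem mem_supportIdeal_of_pow_mem {J : Finset σ → Ideal W} {hJ : Monotone J}
    (h : ∀ S, J S = ⊤ ∨ (J S).IsPrime) {f : MvPowerSeries σ W} {N : ℕ}
    (hf : f ^ N ∈ supportIdeal J hJ) : f ∈ supportIdeal J hJ := by
  rw [mem_supportIdeal_iff_restrict] at hf ⊢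
  intro S
  have h1 := hf S
  rcases h S with h2 | h2
  · have := Ideal.Quotient.subsingleton_iff.mpr h2
    ext α
    exact Subsingleton.elim _ _
  · rw [map_pow, map_pow] at h1
    exact eq_zero_of_pow_eq_zero h1

theorem natCast_mul_coeff (c : ℕ) (f : MvPowerSeries σ W) (α : σ →₀ ℕ) :
    coeff α ((c : MvPowerSeries σ W) * f) = c * coeff α f := by
  rw [← map_natCast (C : W →+* MvPowerSeries σ W), coeff_C_mul]

theorem mem_supportIdeal_sup_iff {J : Finset σ → Ideal W} {hJ : Monotone J} (c : ℕ)
    (hJ' : Monotone fun S => J S ⊔ Ideal.span {(c : W)}) {f : MvPowerSeries σ W} :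
    f ∈ supportIdeal _ hJ' ↔
      ∃ g ∈ supportIdeal J hJ, (c : MvPowerSeries σ W) ∣ f - g := by
  constructor
  · intro hf
    have h1 : ∀ α, ∃ a ∈ J α.support, ∃ b, coeff α f = a + c * b := by
      intro α
      obtain ⟨a, ha, b, hb, h⟩ := Submodule.mem_sup.mp (hf α)
      obtain ⟨d, rfl⟩ := Ideal.mem_span_singleton.mp hb
      exact ⟨a, ha, d, h.symm⟩
    choose a ha b hb using h1
    refine ⟨ofCoeff a, ha, ofCoeff b, ?_⟩
    ext α
    rw [natCast_mul_coeff, map_sub, hb, coeff_ofCoeff, coeff_ofCoeff, add_sub_cancel_left]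
  · rintro ⟨g, hg, w, hw⟩ α
    rw [← sub_add_cancel f g, hw, map_add, natCast_mul_coeff, add_comm]
    exact Submodule.add_mem_sup (hg α) (Ideal.mul_mem_right _ _ (Ideal.mem_span_singleton_self _))

theorem dvd_mk_supportIdeal_iff {J : Finset σ → Ideal W} {hJ : Monotone J} (c : ℕ)
    (hJ' : Monotone fun S => J S ⊔ Ideal.span {(c : W)}) {f : MvPowerSeries σ W} :
    (c : MvPowerSeries σ W ⧸ supportIdeal J hJ) ∣ Ideal.Quotient.mk _ f ↔
      f ∈ supportIdeal _ hJ' := by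
  rw [mem_supportIdeal_sup_iff (hJ := hJ)]
  constructor
  · rintro ⟨w, hw⟩
    obtain ⟨g, rfl⟩ := Ideal.Quotient.mk_surjective w
    rw [← map_natCast (Ideal.Quotient.mk _), ← map_mul, Ideal.Quotient.mk_eq_mk_iff_sub_mem] at hw
    exact ⟨_, hw, g, sub_sub_cancel _ _⟩
  · rintro ⟨g, hg, w, hw⟩
    refine ⟨Ideal.Quotient.mk _ w, ?_⟩
    rw [← map_natCast (Ideal.Quotient.mk _), ← map_mul, Ideal.Quotient.mk_eq_mk_iff_sub_mem, ← hw,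
      sub_sub_cancel]
    exact hg

theorem natCast_mul_mk_supportIdeal_eq_zero_iff {J : Finset σ → Ideal W} {hJ : Monotone J}
    (c : ℕ) (f : MvPowerSeries σ W) :
    (c : MvPowerSeries σ W ⧸ supportIdeal J hJ) * Ideal.Quotient.mk _ f = 0 ↔
      ∀ α, c * coeff α f ∈ J α.support := by
  rw [← map_natCast (Ideal.Quotient.mk _), ← map_mul, Ideal.Quotient.eq_zero_iff_mem,
    mem_supportIdeal]
  simp only [natCast_mul_coeff]

theorem isPReducedBase_quotient_supportIdeal [IsDomain W] {p : ℕ}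
    (hmax : (Ideal.span {(p : W)}).IsMaximal) (hp : (p : W) ≠ 0)
    (hjac : (p : W) ∈ Ideal.jacobson (⊥ : Ideal W))
    (hsep : ∀ c : W, (∀ m : ℕ, (p : W) ^ m ∣ c) → c = 0)
    (J : Finset σ → Ideal W) (hJ : Monotone J)
    (hv : ∀ S, J S = ⊥ ∨ J S = Ideal.span {(p : W)} ∨ J S = ⊤) :
    IsPReducedBase p (MvPowerSeries σ W ⧸ supportIdeal J hJ) := by
  have hprime : ∀ K : Ideal W, Ideal.span {(p : W)} ≤ K → K = ⊤ ∨ K.IsPrime := by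
    intro K hK
    by_cases h : K = ⊤
    · exact Or.inl h
    · exact Or.inr (hmax.eq_of_le h hK ▸ hmax.isPrime)
  have hJ1 : Monotone fun S => J S ⊔ Ideal.span {(p : W)} :=
    fun S T h => sup_le_sup_right (hJ h) _
  let J' : Finset σ → Ideal W := fun S => Submodule.comap (LinearMap.mulLeft W (p : W)) (J S)
  have hJ' : Monotone J' := fun S T h => Submodule.comap_mono (hJ h)
  have hJ2 : Monotone fun S => J' S ⊔ Ideal.span {(p : W)} :=
    fun S T h => sup_le_sup_right (hJ' h) _
  have hle : ∀ S, J S ≤ J' S := fun S c hc => Ideal.mul_mem_left _ _ hc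
  refine ⟨fun r N h => ?_, fun r s N hs h => ?_, fun r h => ?_, fun r h => ?_, ?_⟩
  · obtain ⟨f, rfl⟩ := Ideal.Quotient.mk_surjective r
    rw [← map_pow, dvd_mk_supportIdeal_iff p hJ1] at h
    rw [dvd_mk_supportIdeal_iff p hJ1]
    exact mem_supportIdeal_of_pow_mem (fun S => hprime _ le_sup_right) h
  · obtain ⟨f, rfl⟩ := Ideal.Quotient.mk_surjective r
    obtain ⟨g, rfl⟩ := Ideal.Quotient.mk_surjective s
    rw [natCast_mul_mk_supportIdeal_eq_zero_iff] at hs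
    rw [← map_pow, ← map_sub, dvd_mk_supportIdeal_iff p hJ1] at h
    have h1 : f ^ N ∈ supportIdeal _ hJ2 := by
      intro α
      rw [← sub_add_cancel (f ^ N) g, map_add]
      exact add_mem (sup_le_sup_right (hle _) _ (h α)) (Submodule.mem_sup_left (hs α))
    have h2 := mem_supportIdeal_of_pow_mem (fun S => hprime _ le_sup_right) h1
    obtain ⟨g', hg', w, hw⟩ := (mem_supportIdeal_sup_iff (hJ := hJ') p hJ2).mp h2
    refine ⟨Ideal.Quotient.mk _ g', ?_, Ideal.Quotient.mk _ w, ?_⟩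
    · rw [natCast_mul_mk_supportIdeal_eq_zero_iff]
      exact hg'
    · rw [← map_sub, hw, map_mul, map_natCast]
  · obtain ⟨f, rfl⟩ := Ideal.Quotient.mk_surjective r
    rw [Ideal.Quotient.eq_zero_iff_mem]
    intro α
    have h1 : ∀ m : ℕ, coeff α f ∈ J α.support ⊔ Ideal.span {(p : W) ^ m} := by
      intro m
      have h2 := h m
      rw [← Nat.cast_pow, dvd_mk_supportIdeal_iff _ fun S T h => sup_le_sup_right (hJ h) _] at h2
      simpa using h2 α
    rcases hv α.support with h2 | h2 | h2
    · rw [h2, Ideal.mem_bot]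
      refine hsep _ fun m => ?_
      simpa [h2, Ideal.mem_span_singleton] using h1 m
    · simpa [h2] using h1 1
    · rw [h2]
      exact Submodule.mem_top
  · obtain ⟨f, rfl⟩ := Ideal.Quotient.mk_surjective r
    rw [← mul_assoc, ← Nat.cast_mul, natCast_mul_mk_supportIdeal_eq_zero_iff] at h
    rw [natCast_mul_mk_supportIdeal_eq_zero_iff]
    intro α
    have h1 := h α
    rcases hv α.support with h2 | h2 | h2
    · rw [h2, Ideal.mem_bot] at h1 ⊢
      rw [Nat.cast_mul, mul_assoc] at h1
      exact (mul_eq_zero.mp h1).resolve_left hp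
    · rw [h2]
      exact Ideal.mul_mem_right _ _ (Ideal.mem_span_singleton_self _)
    · rw [h2]
      exact Submodule.mem_top
  · rw [Ideal.mem_jacobson_bot] at hjac ⊢
    intro r
    obtain ⟨f, rfl⟩ := Ideal.Quotient.mk_surjective r
    rw [← map_natCast (Ideal.Quotient.mk _), ← map_mul, ← map_one (Ideal.Quotient.mk _), ← map_add]
    refine IsUnit.map _ (isUnit_iff_constantCoeff.mpr ?_)
    rw [map_add, map_mul, map_natCast, map_one]
    exact hjac _

/-- An ideal generated by terms `c x ^ e`, described through its coefficients. -/
theorem span_monomial_eq_supportIdeal [Finite σ] (E : Set ((σ →₀ ℕ) × W))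
    (hE : ∀ t ∈ E, ∀ j, t.1 j ≤ 1) (J : Finset σ → Ideal W) (hJ : Monotone J)
    (hmem : ∀ t ∈ E, t.2 ∈ J t.1.support)
    (hv : ∀ S, J S = ⊥ ∨ ∃ t ∈ E, t.1.support ⊆ S ∧ J S = Ideal.span {t.2}) :
    Ideal.span ((fun t : (σ →₀ ℕ) × W => monomial t.1 t.2) '' E) = supportIdeal J hJ := by
  classical
  apply le_antisymm
  · rw [Ideal.span_le]
    rintro _ ⟨t, ht, rfl⟩ α
    rw [coeff_monomial]
    split_ifs with h
    · rw [h]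
      exact hmem t ht
    · exact zero_mem _
  · intro f hf
    have := Fintype.ofFinite σ
    let g : Finset σ → MvPowerSeries σ W := fun S =>
      ofCoeff fun α => if α.support = S then coeff α f else 0
    have hg : ∀ S α, coeff α (g S) = if α.support = S then coeff α f else 0 := fun _ _ => rfl
    have hfg : f = ∑ S, g S := by
      ext α
      simp only [map_sum, hg, Finset.sum_ite_eq, Finset.mem_univ, if_true]
    rw [hfg]
    refine sum_mem fun S _ => ?_
    have hgS : ∀ α, coeff α (g S) ∈ J S := by
      intro α
      rw [hg]
      split_ifs with h
      · exact h ▸ hf α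
      · exact zero_mem _
    rcases hv S with h | ⟨t, ht, htS, h⟩
    · have : g S = 0 := by
        ext α
        rw [map_zero, ← Ideal.mem_bot, ← h]
        exact hgS α
      rw [this]
      exact zero_mem _
    · simp only [h, Ideal.mem_span_singleton] at hgS
      choose b hb using hgS
      have : g S = monomial t.1 t.2 * ofCoeff fun β => b (β + t.1) := by
        ext α
        rw [coeff_monomial_mul]
        split_ifs with hα
        · rw [coeff_ofCoeff (fun β => b (β + t.1)), tsub_add_cancel_of_le hα, hb]
        · rw [hg, if_neg]
          rintro rfl
          refine hα fun j => ?_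
          by_cases hj : t.1 j = 0
          · rw [hj]
            exact Nat.zero_le _
          · exact (hE t ht j).trans (Nat.one_le_iff_ne_zero.mpr
              (Finsupp.mem_support_iff.mp (htS (Finsupp.mem_support_iff.mpr hj))))
      rw [this]
      exact Ideal.mul_mem_right _ _ (Ideal.subset_span ⟨t, ht, rfl⟩)

end SupportIdeal

end MvPowerSeries

namespace MvPowerSeries

/-- An ideal generated by terms `x ^ e` and `c x ^ e` with squarefree `x ^ e`, described through
its coefficients. -/
theorem exists_span_monomial_eq_supportIdeal {σ W : Type*} [CommRing W] [Finite σ] (c : W)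
    (E : Set ((σ →₀ ℕ) × W)) (hE : ∀ t ∈ E, ∀ j, t.1 j ≤ 1) (hc : ∀ t ∈ E, t.2 = 1 ∨ t.2 = c) :
    ∃ (J : Finset σ → Ideal W) (hJ : Monotone J),
      (∀ S, J S = ⊥ ∨ J S = Ideal.span {c} ∨ J S = ⊤) ∧
        Ideal.span ((fun t : (σ →₀ ℕ) × W => monomial t.1 t.2) '' E) = supportIdeal J hJ := by
  let J : Finset σ → Ideal W := fun S =>
    Ideal.span ((fun t : (σ →₀ ℕ) × W => t.2) '' {t ∈ E | t.1.support ⊆ S})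
  have hJ : Monotone J := fun S T h =>
    Ideal.span_mono (Set.image_mono fun t ht => ⟨ht.1, ht.2.trans h⟩)
  have hmem : ∀ S, ∀ t ∈ E, t.1.support ⊆ S → t.2 ∈ J S := fun S t ht hS =>
    Ideal.subset_span ⟨t, ⟨ht, hS⟩, rfl⟩
  have hv : ∀ S, J S = ⊥ ∨ ∃ t ∈ E, t.1.support ⊆ S ∧ J S = Ideal.span {t.2} := by
    intro S
    by_cases h1 : ∃ t ∈ E, t.1.support ⊆ S ∧ t.2 = 1
    · obtain ⟨t, ht, htS, h⟩ := h1
      refine Or.inr ⟨t, ht, htS, ?_⟩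
      rw [h, Ideal.span_singleton_one, Ideal.eq_top_iff_one, ← h]
      exact hmem S t ht htS
    · by_cases h2 : ∃ t ∈ E, t.1.support ⊆ S
      · obtain ⟨t, ht, htS⟩ := h2
        have hS : ∀ t ∈ E, t.1.support ⊆ S → t.2 = c := fun t ht htS =>
          (hc t ht).resolve_left fun h => h1 ⟨t, ht, htS, h⟩
        refine Or.inr ⟨t, ht, htS, le_antisymm (Ideal.span_le.mpr ?_) ?_⟩
        · rintro _ ⟨s, ⟨hs, hsS⟩, rfl⟩
          change s.2 ∈ _
          rw [hS s hs hsS, hS t ht htS]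
          exact Ideal.mem_span_singleton_self _
        · rw [Ideal.span_singleton_le_iff_mem]
          exact hmem S t ht htS
      · refine Or.inl (Ideal.span_eq_bot.mpr ?_)
        rintro _ ⟨s, ⟨hs, hsS⟩, rfl⟩
        exact absurd ⟨s, hs, hsS⟩ h2
  refine ⟨J, hJ, fun S => ?_, span_monomial_eq_supportIdeal E hE J hJ
    (fun t ht => hmem _ t ht subset_rfl) hv⟩
  rcases hv S with h | ⟨t, ht, -, h⟩
  · exact Or.inl h
  · rcases hc t ht with h1 | h1
    · exact Or.inr (Or.inr (by rw [h, h1, Ideal.span_singleton_one]))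
    · exact Or.inr (Or.inl (by rw [h, h1]))

end MvPowerSeries

section WittSeries

variable (p : ℕ) [hp : Fact p.Prime] (k : Type u) [Field k] (n : ℕ)

theorem prod_wittParam_pow (ε : Fin (n + 1) → ℕ) :
    ∏ j, wittParam p k n j ^ ε j =
      MvPowerSeries.monomial (Finsupp.equivFunOnFinite.symm fun j : Fin n => ε j.succ)
        ((p : WittVector p k) ^ ε 0) := by
  have h1 : ∑ j : Fin n, Finsupp.single j (ε j.succ) =
      Finsupp.equivFunOnFinite.symm fun j : Fin n => ε j.succ := by
    ext j
    simp [Finsupp.finsetSum_apply, Finsupp.single_apply]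
  rw [Fin.prod_univ_succ, ← h1]
  simp only [wittParam, Fin.cons_zero, Fin.cons_succ, MvPowerSeries.X_pow_eq]
  rw [MvPowerSeries.prod_monomial, Finset.prod_const_one,
    ← map_natCast (MvPowerSeries.C : WittVector p k →+* WittSeries p k n), ← map_pow,
    ← MvPowerSeries.monomial_zero_eq_C_apply, MvPowerSeries.monomial_mul_monomial, zero_add,
    mul_one]

variable {p k n}

theorem IsSquarefreeMonomialIdeal.exists_eq_supportIdeal {I : Ideal (WittSeries p k n)}
    (hI : IsSquarefreeMonomialIdeal (wittParam p k n) I) :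
    ∃ (J : Finset (Fin n) → Ideal (WittVector p k)) (hJ : Monotone J),
      (∀ S, J S = ⊥ ∨ J S = Ideal.span {(p : WittVector p k)} ∨ J S = ⊤) ∧
        I = MvPowerSeries.supportIdeal J hJ := by
  obtain ⟨M, hM, rfl⟩ := hI
  choose! ε hε hm using hM
  let t : WittSeries p k n → (Fin n →₀ ℕ) × WittVector p k := fun m =>
    (Finsupp.equivFunOnFinite.symm fun j : Fin n => ε m j.succ, (p : WittVector p k) ^ ε m 0)
  obtain ⟨J, hJ, hv, h⟩ := MvPowerSeries.exists_span_monomial_eq_supportIdeal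
    (p : WittVector p k) (t '' M)
    (by
      rintro _ ⟨m, hmM, rfl⟩ j
      rcases hε m hmM j.succ with h | h <;> simp [t, h])
    (by
      rintro _ ⟨m, hmM, rfl⟩
      rcases hε m hmM 0 with h | h <;> simp [t, h])
  refine ⟨J, hJ, hv, ?_⟩
  rw [← h, Set.image_image]
  congr 1
  refine (Set.image_id M).symm.trans (Set.image_congr fun m hmM => ?_)
  rw [← prod_wittParam_pow, ← hm m hmM, id]

theorem IsSquarefreeMonomialIdeal.isPReducedBase [CharP k p] [PerfectField k]
    {I : Ideal (WittSeries p k n)} (hI : IsSquarefreeMonomialIdeal (wittParam p k n) I) :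
    IsPReducedBase p (WittSeries p k n ⧸ I) := by
  have : ExpChar k p := ExpChar.prime hp.out
  have : PerfectRing k p := PerfectField.toPerfectRing p
  obtain ⟨J, hJ, hv, rfl⟩ := hI.exists_eq_supportIdeal
  have hmax : (Ideal.span {(p : WittVector p k)}).IsMaximal := by
    rw [← WittVector.ker_constantCoeff]
    refine RingHom.ker_isMaximal_of_surjective _ fun a => ⟨WittVector.teichmuller p a, ?_⟩
    exact WittVector.teichmuller_coeff_zero p a
  refine MvPowerSeries.isPReducedBase_quotient_supportIdeal hmax (WittVector.p_nonzero p k) ?_ ?_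
    J hJ hv
  · exact IsAdicComplete.le_jacobson_bot (Ideal.span {(p : WittVector p k)})
      (Ideal.mem_span_singleton_self _)
  · intro c hc
    ext m
    have h := hc (m + 1)
    rw [← Ideal.mem_span_singleton, WittVector.mem_span_p_pow_iff_le_coeff_eq_zero] at h
    rw [h m m.lt_succ_self, WittVector.zero_coeff]

end WittSeries

theorem mainTheorem4 (p : ℕ) [Fact p.Prime] (k : Type u) [Field k] [CharP k p] [PerfectField k]
    (n : ℕ) (I : Ideal (WittSeries p k n))
    (hI : IsSquarefreeMonomialIdeal (wittParam p k n) I) :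
    (tensorTower (WittVector p k) p hI.phi).reduced.IsPerfectoid p
        (tensorTower.baseMap (WittVector p k) p hI.phi)
        (Ideal.span {(p : WittSeries p k n ⧸ I)}) ∧
      ∀ i : ℕ,
        (∃ s : (tensorTower (WittVector p k) p hI.phi).reduced.ring i,
            s ≠ 0 ∧ (p : (tensorTower (WittVector p k) p hI.phi).reduced.ring i) * s = 0) ↔
          ∃ a : WittSeries p k n, a ∉ I ∧ (p : WittSeries p k n) * a ∈ I := by
  have hR := hI.isPReducedBase
  have hφ : ∀ r, (p : WittSeries p k n ⧸ I) ∣ hI.phi r - r ^ p := by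
    intro r
    obtain ⟨f, rfl⟩ := Ideal.Quotient.mk_surjective r
    have h := map_dvd (Ideal.Quotient.mk I) (dvd_wittPhi_sub_pow p k n f)
    rw [map_natCast, map_sub, map_pow] at h
    exact h
  refine ⟨tensorTower.isPerfectoid _ p _ hR hφ, fun i => ?_⟩
  refine ((tensorTower.isReducedRootTower _ p hI.phi hR).exists_mul_eq_zero_iff hR i).trans ?_
  rw [Ideal.Quotient.mk_surjective.exists]
  refine exists_congr fun a => ?_
  rw [← Ideal.Quotient.eq_zero_iff_mem, ← Ideal.Quotient.eq_zero_iff_mem, map_mul, map_natCast]
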